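/- Let $n\in\{2,3\}$, let $\Omega\subset\mathbb{R}^n$ be a bounded simply connected domain with $C^\infty$ boundary $\Gamma=\partial\Omega$ and outward unit normal $\boldsymbol{n}$, let $\Gamma$ be the union of two disjoint (measurable, possibly empty) parts $\Gamma_D$ and $\Gamma_N$, and let $\gamma>0$. Let $H^1_D(\Omega)=\{u\in H^1(\Omega): u=0 \text{ on } \Gamma_D\}$ (in the sense of traces) and $\boldsymbol{H}_N(\operatorname{div},\Omega)=\{\boldsymbol\varphi\in L^2(\Omega)^n : \nabla\cdot\boldsymbol\varphi\in L^2(\Omega),\ \boldsymbol\varphi\cdot\boldsymbol n=0 \text{ on } \Gamma_N\}$, where $\boldsymbol\varphi\cdot\boldsymbol n=0$ on $\Gamma_N$ means that $(\boldsymbol\varphi,\nabla v)_\Omega+(\nabla\cdot\boldsymbol\varphi,v)_\Omega=0$ for all $v\in H^1_D(\Omega)$. Write $\|u\|_{H^1}^2=\|u\|_{L^2}^2+\|\nabla u\|_{L^2}^2$ and $\|\boldsymbol\varphi\|_{H(\operatorname{div})}^2=\|\boldsymbol\varphi\|_{L^2}^2+\|\nabla\cdot\boldsymbol\varphi\|_{L^2}^2$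 (norms over $\Omega$), and for $f\in L^2(\Omega)$ put $$b((\boldsymbol\varphi,u),(\boldsymbol\psi,v))=(\nabla\cdot\boldsymbol\varphi+\gamma u,\nabla\cdot\boldsymbol\psi+\gamma v)_\Omega+(\nabla u+\boldsymbol\varphi,\nabla v+\boldsymbol\psi)_\Omega,\qquad F((\boldsymbol\psi,v))=(f,\nabla\cdot\boldsymbol\psi+\gamma v)_\Omega .$$ (i) There are constants $c,C>0$, which may depend on $\Omega,\Gamma_D,\Gamma_N,\gamma$ only, such that for all $(\boldsymbol\varphi,u)\in\boldsymbol{H}_N(\operatorname{div},\Omega)\times H^1_D(\Omega)$ $$c\,\big(\|u\|_{H^1}^2+\|\boldsymbol\varphi\|_{H(\operatorname{div})}^2\big)\le b((\boldsymbol\varphi,u),(\boldsymbol\varphi,u))\le C\,\big(\|u\|_{H^1}^2+\|\boldsymbol\varphi\|_{H(\operatorname{div})}^2\big).$$ (ii) For every $f\in L^2(\Omega)$ there is exactly one $(\boldsymbol\varphi,u)\in\boldsymbol{H}_N(\operatorname{div},\Omega)\times H^1_D(\Omega)$ with $b((\boldsymbol\varphi,u),(\boldsymbol\psi,v))=F((\boldsymbol\psi,v))$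 for all $(\boldsymbol\psi,v)\in\boldsymbol{H}_N(\operatorname{div},\Omega)\times H^1_D(\Omega)$. (iii) For all finite-dimensional subspaces $V_h\subseteq\boldsymbol{H}_N(\operatorname{div},\Omega)$ and $S_h\subseteq H^1_D(\Omega)$ (in particular, for conforming finite element spaces) and every $f\in L^2(\Omega)$ there is exactly one $(\boldsymbol\varphi_h,u_h)\in V_h\times S_h$ with $b((\boldsymbol\varphi_h,u_h),(\boldsymbol\psi_h,v_h))=F((\boldsymbol\psi_h,v_h))$ for all $(\boldsymbol\psi_h,v_h)\in V_h\times S_h$. -/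

import Mathlib

open MeasureTheory Filter Topology TopologicalSpace
open scoped ContDiff ENNReal

namespace FOSLS

/-! ### Domains -/

/-- The Euclidean space of dimension `n`. -/
abbrev Space (n : ℕ) : Type := EuclideanSpace ℝ (Fin n)

/-- The set `Ω` has `C^∞` boundary: near each boundary point it is a strict sublevel set of a smooth
function whose differential does not vanish at that point (so `Ω` lies locally on one side of its
boundary). -/
def HasSmoothBoundary {n : ℕ} (Ω : Set (Space n)) : Prop :=
  ∀ x ∈ frontier Ω, ∃ ρ : Space n → ℝ, ContDiff ℝ ∞ ρ ∧ fderiv ℝ ρ x ≠ 0 ∧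
    ∀ᶠ y in 𝓝 x, (y ∈ Ω ↔ ρ y < 0)

/-- The surface measure on hypersurfaces: the `(n-1)`-dimensional Hausdorff measure. -/
noncomputable abbrev surfaceMeasure (n : ℕ) : Measure (Space n) :=
  Measure.hausdorffMeasure ((n : ℝ) - 1)

/-- `L²(Ω)`. -/
abbrev L2 {n : ℕ} (Ω : Opens (Space n)) : Type :=
  Lp ℝ 2 (volume.restrict (Ω : Set (Space n)))

/-- `L²(Ω)ⁿ`. -/
abbrev L2Vec {n : ℕ} (Ω : Opens (Space n)) : Type :=
  Lp (Space n) 2 (volume.restrict (Ω : Set (Space n)))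

/-! ### Weak gradient and weak divergence -/

/-- `ψ` is a test function on `Ω`, i.e. an element of `C_c^∞(Ω)`. -/
def IsTest {n : ℕ} (Ω : Opens (Space n)) (ψ : Space n → ℝ) : Prop :=
  ContDiff ℝ ∞ ψ ∧ HasCompactSupport ψ ∧ tsupport ψ ⊆ (Ω : Set (Space n))

/-- `g` is the weak gradient of `u` in `Ω`: `∫_Ω u ∇ψ = - ∫_Ω ψ g` for all test functions `ψ`. -/
def HasWeakGrad {n : ℕ} (Ω : Opens (Space n)) (u : L2 Ω) (g : L2Vec Ω) : Prop :=
  ∀ ψ : Space n → ℝ, IsTest Ω ψ →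
    ∫ x in (Ω : Set (Space n)), u x • gradient ψ x = - ∫ x in (Ω : Set (Space n)), ψ x • g x

/-- `d` is the weak divergence of `φ` in `Ω`: `∫_Ω φ ⬝ ∇ψ = - ∫_Ω ψ d` for all test functions. -/
def HasWeakDiv {n : ℕ} (Ω : Opens (Space n)) (φ : L2Vec Ω) (d : L2 Ω) : Prop :=
  ∀ ψ : Space n → ℝ, IsTest Ω ψ →
    ∫ x in (Ω : Set (Space n)), inner ℝ (φ x) (gradient ψ x) =
      - ∫ x in (Ω : Set (Space n)), ψ x • d x

section Helpers

variable {n : ℕ} {Ω : Opens (Space n)}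

theorem continuous_gradient_of_contDiff {ψ : Space n → ℝ} (h : ContDiff ℝ ∞ ψ) :
    Continuous (gradient ψ) :=
  (InnerProductSpace.toDual ℝ (Space n)).symm.continuous.comp (h.continuous_fderiv (by simp))

theorem IsTest.memLp {ψ : Space n → ℝ} (h : IsTest Ω ψ) :
    MemLp ψ 2 (volume.restrict (Ω : Set (Space n))) :=
  (h.1.continuous.memLp_of_hasCompactSupport h.2.1).restrict _

theorem IsTest.memLp_gradient {ψ : Space n → ℝ} (h : IsTest Ω ψ) :
    MemLp (gradient ψ) 2 (volume.restrict (Ω : Set (Space n))) := by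
  refine ((continuous_gradient_of_contDiff h.1).memLp_of_hasCompactSupport ?_).restrict _
  exact (h.2.1.fderiv (𝕜 := ℝ)).comp_left
    (g := (InnerProductSpace.toDual ℝ (Space n)).symm) (map_zero _)

theorem integrable_smul_of_memLp {F : Type*} [NormedAddCommGroup F] [NormedSpace ℝ F]
    {μ : Measure (Space n)} {f : Space n → ℝ} {g : Space n → F}
    (hf : MemLp f 2 μ) (hg : MemLp g 2 μ) : Integrable (fun x => f x • g x) μ :=
  memLp_one_iff_integrable.1 (hg.smul hf)

theorem integrable_inner_of_memLp {μ : Measure (Space n)} {f g : Space n → Space n}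
    (hf : MemLp f 2 μ) (hg : MemLp g 2 μ) : Integrable (fun x => inner ℝ (f x) (g x)) μ :=
  memLp_one_iff_integrable.1
    (MemLp.of_bilin (r := 1) (fun a b => inner ℝ a b) 1 hf hg
      (hf.1.inner hg.1) (ae_of_all _ fun x => by
        simpa using nnnorm_inner_le_nnnorm (𝕜 := ℝ) (f x) (g x)))

/-- An `L²(Ω)` function that integrates to zero against all test functions vanishes. -/
theorem eq_zero_of_forall_test {F : Type*} [NormedAddCommGroup F] [NormedSpace ℝ F]
    [CompleteSpace F] (f : Lp F 2 (volume.restrict (Ω : Set (Space n))))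
    (h : ∀ ψ : Space n → ℝ, IsTest Ω ψ → ∫ x in (Ω : Set (Space n)), ψ x • f x = 0) : f = 0 := by
  have hloc : LocallyIntegrableOn (f : Space n → F) (Ω : Set (Space n)) volume := by
    intro x hx
    obtain ⟨K, hK, hKn, hKs⟩ := local_compact_nhds (Ω.isOpen.mem_nhds hx)
    refine ⟨K, mem_nhdsWithin_of_mem_nhds hK, ?_⟩
    have h1 : MemLp (f : Space n → F) 2 (volume.restrict K) := by
      have := (Lp.memLp f).restrict K
      rwa [Measure.restrict_restrict_of_subset hKn] at this
    have : IsFiniteMeasure (volume.restrict K) := ⟨by simpa using hKs.measure_lt_top⟩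
    exact h1.integrable (by norm_num)
  have key := Ω.isOpen.ae_eq_zero_of_integral_contDiff_smul_eq_zero hloc (by
    intro g hg hgc hgs
    rw [← h g ⟨hg, hgc, hgs⟩, setIntegral_eq_integral_of_forall_compl_eq_zero]
    intro x hx
    have : x ∉ tsupport g := fun hx' => hx (hgs hx')
    rw [image_eq_zero_of_notMem_tsupport this, zero_smul])
  rw [Lp.eq_zero_iff_ae_eq_zero]
  exact (ae_restrict_iff' Ω.isOpen.measurableSet).2 key

theorem HasWeakGrad.add {u v : L2 Ω} {g k : L2Vec Ω} (hu : HasWeakGrad Ω u g)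
    (hv : HasWeakGrad Ω v k) : HasWeakGrad Ω (u + v) (g + k) := by
  intro ψ hψ
  have e1 : ∫ x in (Ω : Set (Space n)), (u + v : L2 Ω) x • gradient ψ x =
      ∫ x in (Ω : Set (Space n)), (u x • gradient ψ x + v x • gradient ψ x) :=
    integral_congr_ae (by
      filter_upwards [Lp.coeFn_add u v] with x hx
      rw [hx, Pi.add_apply, add_smul])
  have e2 : ∫ x in (Ω : Set (Space n)), ψ x • (g + k : L2Vec Ω) x =
      ∫ x in (Ω : Set (Space n)), (ψ x • g x + ψ x • k x) :=
    integral_congr_ae (by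
      filter_upwards [Lp.coeFn_add g k] with x hx
      rw [hx, Pi.add_apply, smul_add])
  rw [e1, e2, integral_add (integrable_smul_of_memLp (Lp.memLp u) hψ.memLp_gradient)
    (integrable_smul_of_memLp (Lp.memLp v) hψ.memLp_gradient),
    integral_add (integrable_smul_of_memLp hψ.memLp (Lp.memLp g))
    (integrable_smul_of_memLp hψ.memLp (Lp.memLp k)), hu ψ hψ, hv ψ hψ, neg_add]

theorem HasWeakGrad.smul (c : ℝ) {u : L2 Ω} {g : L2Vec Ω} (hu : HasWeakGrad Ω u g) :
    HasWeakGrad Ω (c • u) (c • g) := by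
  intro ψ hψ
  have e1 : ∫ x in (Ω : Set (Space n)), (c • u : L2 Ω) x • gradient ψ x =
      ∫ x in (Ω : Set (Space n)), c • (u x • gradient ψ x) :=
    integral_congr_ae (by
      filter_upwards [Lp.coeFn_smul c u] with x hx
      rw [hx, Pi.smul_apply, smul_assoc])
  have e2 : ∫ x in (Ω : Set (Space n)), ψ x • (c • g : L2Vec Ω) x =
      ∫ x in (Ω : Set (Space n)), c • (ψ x • g x) :=
    integral_congr_ae (by
      filter_upwards [Lp.coeFn_smul c g] with x hx
      rw [hx, Pi.smul_apply, smul_comm])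
  rw [e1, e2, integral_smul, integral_smul, hu ψ hψ, smul_neg]

theorem HasWeakGrad.zero : HasWeakGrad Ω (0 : L2 Ω) 0 := by
  intro ψ _
  rw [integral_eq_zero_of_ae, integral_eq_zero_of_ae, neg_zero]
  · filter_upwards [Lp.coeFn_zero (Space n) 2 (volume.restrict (Ω : Set (Space n)))] with x hx
    rw [hx]; simp
  · filter_upwards [Lp.coeFn_zero ℝ 2 (volume.restrict (Ω : Set (Space n)))] with x hx
    rw [hx]; simp

theorem HasWeakDiv.add {φ η : L2Vec Ω} {d e : L2 Ω} (hφ : HasWeakDiv Ω φ d)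
    (hη : HasWeakDiv Ω η e) : HasWeakDiv Ω (φ + η) (d + e) := by
  intro ψ hψ
  have e1 : ∫ x in (Ω : Set (Space n)), inner ℝ ((φ + η : L2Vec Ω) x) (gradient ψ x) =
      ∫ x in (Ω : Set (Space n)), (inner ℝ (φ x) (gradient ψ x) + inner ℝ (η x) (gradient ψ x)) :=
    integral_congr_ae (by
      filter_upwards [Lp.coeFn_add φ η] with x hx
      rw [hx, Pi.add_apply, inner_add_left])
  have e2 : ∫ x in (Ω : Set (Space n)), ψ x • (d + e : L2 Ω) x =
      ∫ x in (Ω : Set (Space n)), (ψ x • d x + ψ x • e x) :=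
    integral_congr_ae (by
      filter_upwards [Lp.coeFn_add d e] with x hx
      rw [hx, Pi.add_apply, smul_add])
  rw [e1, e2, integral_add (integrable_inner_of_memLp (Lp.memLp φ) hψ.memLp_gradient)
    (integrable_inner_of_memLp (Lp.memLp η) hψ.memLp_gradient),
    integral_add (integrable_smul_of_memLp hψ.memLp (Lp.memLp d))
    (integrable_smul_of_memLp hψ.memLp (Lp.memLp e)), hφ ψ hψ, hη ψ hψ, neg_add]

theorem HasWeakDiv.smul (c : ℝ) {φ : L2Vec Ω} {d : L2 Ω} (hφ : HasWeakDiv Ω φ d) :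
    HasWeakDiv Ω (c • φ) (c • d) := by
  intro ψ hψ
  have e1 : ∫ x in (Ω : Set (Space n)), inner ℝ ((c • φ : L2Vec Ω) x) (gradient ψ x) =
      ∫ x in (Ω : Set (Space n)), c • inner ℝ (φ x) (gradient ψ x) :=
    integral_congr_ae (by
      filter_upwards [Lp.coeFn_smul c φ] with x hx
      rw [hx, Pi.smul_apply, real_inner_smul_left, smul_eq_mul])
  have e2 : ∫ x in (Ω : Set (Space n)), ψ x • (c • d : L2 Ω) x =
      ∫ x in (Ω : Set (Space n)), c • (ψ x • d x) :=
    integral_congr_ae (by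
      filter_upwards [Lp.coeFn_smul c d] with x hx
      rw [hx, Pi.smul_apply, smul_comm])
  rw [e1, e2, integral_smul, integral_smul, hφ ψ hψ, smul_neg]

theorem HasWeakDiv.zero : HasWeakDiv Ω (0 : L2Vec Ω) 0 := by
  intro ψ _
  rw [integral_eq_zero_of_ae, integral_eq_zero_of_ae, neg_zero]
  · filter_upwards [Lp.coeFn_zero ℝ 2 (volume.restrict (Ω : Set (Space n)))] with x hx
    rw [hx]; simp
  · filter_upwards [Lp.coeFn_zero (Space n) 2 (volume.restrict (Ω : Set (Space n)))] with x hx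
    rw [hx]; simp

theorem HasWeakGrad.unique {u : L2 Ω} {g k : L2Vec Ω} (hg : HasWeakGrad Ω u g)
    (hk : HasWeakGrad Ω u k) : g = k := by
  have h := hg.add (hk.smul (-1))
  rw [← sub_eq_zero]
  refine eq_zero_of_forall_test _ fun ψ hψ => ?_
  have := h ψ hψ
  have e0 : u + (-1 : ℝ) • u = 0 := by simp
  have e1 : g + (-1 : ℝ) • k = g - k := by simp [sub_eq_add_neg]
  have z : ∫ x in (Ω : Set (Space n)), (0 : L2 Ω) x • gradient ψ x = 0 :=
    integral_eq_zero_of_ae (by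
      filter_upwards [Lp.coeFn_zero ℝ 2 (volume.restrict (Ω : Set (Space n)))] with x hx
      rw [hx]; simp)
  rw [e0, e1, z] at this
  exact neg_eq_zero.1 this.symm

theorem HasWeakDiv.unique {φ : L2Vec Ω} {d e : L2 Ω} (hd : HasWeakDiv Ω φ d)
    (he : HasWeakDiv Ω φ e) : d = e := by
  have h := hd.add (he.smul (-1))
  rw [← sub_eq_zero]
  refine eq_zero_of_forall_test _ fun ψ hψ => ?_
  have := h ψ hψ
  have e0 : φ + (-1 : ℝ) • φ = 0 := by simp
  have e1 : d + (-1 : ℝ) • e = d - e := by simp [sub_eq_add_neg]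
  have z : ∫ x in (Ω : Set (Space n)), inner ℝ ((0 : L2Vec Ω) x) (gradient ψ x) = 0 :=
    integral_eq_zero_of_ae (by
      filter_upwards [Lp.coeFn_zero (Space n) 2 (volume.restrict (Ω : Set (Space n)))] with x hx
      rw [hx]; simp)
  rw [e0, e1, z] at this
  exact neg_eq_zero.1 this.symm

end Helpers

/-! ### The spaces `H¹(Ω)` and `H(div, Ω)` -/

/-- `H¹(Ω) = {u ∈ L²(Ω) : ∇u ∈ L²(Ω)ⁿ}`. -/
def H1 {n : ℕ} (Ω : Opens (Space n)) : Submodule ℝ (L2 Ω) where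
  carrier := {u | ∃ g : L2Vec Ω, HasWeakGrad Ω u g}
  add_mem' := fun ⟨g, hg⟩ ⟨k, hk⟩ => ⟨g + k, hg.add hk⟩
  zero_mem' := ⟨0, HasWeakGrad.zero⟩
  smul_mem' := fun c _ ⟨g, hg⟩ => ⟨c • g, hg.smul c⟩

/-- `H(div, Ω) = {φ ∈ L²(Ω)ⁿ : ∇ ⬝ φ ∈ L²(Ω)}`. -/
def HDiv {n : ℕ} (Ω : Opens (Space n)) : Submodule ℝ (L2Vec Ω) where
  carrier := {φ | ∃ d : L2 Ω, HasWeakDiv Ω φ d}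
  add_mem' := fun ⟨d, hd⟩ ⟨e, he⟩ => ⟨d + e, hd.add he⟩
  zero_mem' := ⟨0, HasWeakDiv.zero⟩
  smul_mem' := fun c _ ⟨d, hd⟩ => ⟨c • d, hd.smul c⟩

/-- The weak gradient `∇ : H¹(Ω) → L²(Ω)ⁿ`. -/
noncomputable def grad {n : ℕ} {Ω : Opens (Space n)} : H1 Ω →ₗ[ℝ] L2Vec Ω where
  toFun u := u.2.choose
  map_add' u v := (u + v).2.choose_spec.unique (u.2.choose_spec.add v.2.choose_spec)
  map_smul' c u := (c • u).2.choose_spec.unique (u.2.choose_spec.smul c)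

/-- The weak divergence `∇ ⬝ : H(div, Ω) → L²(Ω)`. -/
noncomputable def div {n : ℕ} {Ω : Opens (Space n)} : HDiv Ω →ₗ[ℝ] L2 Ω where
  toFun φ := φ.2.choose
  map_add' φ η := (φ + η).2.choose_spec.unique (φ.2.choose_spec.add η.2.choose_spec)
  map_smul' c φ := (c • φ).2.choose_spec.unique (φ.2.choose_spec.smul c)

theorem hasWeakGrad_grad {n : ℕ} {Ω : Opens (Space n)} (u : H1 Ω) :
    HasWeakGrad Ω (u : L2 Ω) (grad u) := u.2.choose_spec

theorem hasWeakDiv_div {n : ℕ} {Ω : Opens (Space n)} (φ : HDiv Ω) :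
    HasWeakDiv Ω (φ : L2Vec Ω) (div φ) := φ.2.choose_spec

/-- The square of the `H¹(Ω)` norm. -/
noncomputable def h1NormSq {n : ℕ} {Ω : Opens (Space n)} (u : H1 Ω) : ℝ :=
  ‖(u : L2 Ω)‖ ^ 2 + ‖grad u‖ ^ 2

/-- The square of the `H(div, Ω)` norm. -/
noncomputable def hdivNormSq {n : ℕ} {Ω : Opens (Space n)} (φ : HDiv Ω) : ℝ :=
  ‖(φ : L2Vec Ω)‖ ^ 2 + ‖div φ‖ ^ 2

/-! ### Boundary conditions -/

/-- The function `g` is the trace of `u ∈ H¹(Ω)` on the part `S` of the boundary: there are functions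
`w k`, smooth up to the boundary, with `w k → u` in `H¹(Ω)` and `w k → g` in `L²(S)` with respect to
the surface measure. -/
def HasTraceOn {n : ℕ} {Ω : Opens (Space n)} (S : Set (Space n)) (u : H1 Ω) (g : Space n → ℝ) :
    Prop :=
  ∃ w : ℕ → Space n → ℝ, (∀ k, ContDiff ℝ ∞ (w k)) ∧
    Tendsto (fun k => eLpNorm (fun x => w k x - (u : L2 Ω) x) 2
      (volume.restrict (Ω : Set (Space n)))) atTop (𝓝 0) ∧
    Tendsto (fun k => eLpNorm (fun x => gradient (w k) x - grad u x) 2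
      (volume.restrict (Ω : Set (Space n)))) atTop (𝓝 0) ∧
    Tendsto (fun k => eLpNorm (fun x => w k x - g x) 2 ((surfaceMeasure n).restrict S)) atTop (𝓝 0)

section Helpers

variable {n : ℕ} {Ω : Opens (Space n)}

theorem tendsto_eLpNorm_add_zero {F : Type*} [NormedAddCommGroup F] {μ : Measure (Space n)}
    {f g h : ℕ → Space n → F} (hf : ∀ k, AEStronglyMeasurable (f k) μ)
    (hg : ∀ k, AEStronglyMeasurable (g k) μ) (hh : ∀ k, h k =ᵐ[μ] f k + g k)
    (tf : Tendsto (fun k => eLpNorm (f k) 2 μ) atTop (𝓝 0))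
    (tg : Tendsto (fun k => eLpNorm (g k) 2 μ) atTop (𝓝 0)) :
    Tendsto (fun k => eLpNorm (h k) 2 μ) atTop (𝓝 0) := by
  have t := tf.add tg
  rw [add_zero] at t
  refine tendsto_of_tendsto_of_tendsto_of_le_of_le tendsto_const_nhds t (fun _ => zero_le)
    fun k => ?_
  rw [eLpNorm_congr_ae (hh k)]
  exact eLpNorm_add_le (hf k) (hg k) (by norm_num)

theorem tendsto_eLpNorm_smul_zero {F : Type*} [NormedAddCommGroup F] [NormedSpace ℝ F]
    {μ : Measure (Space n)} (c : ℝ) {f h : ℕ → Space n → F} (hh : ∀ k, h k =ᵐ[μ] c • f k)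
    (tf : Tendsto (fun k => eLpNorm (f k) 2 μ) atTop (𝓝 0)) :
    Tendsto (fun k => eLpNorm (h k) 2 μ) atTop (𝓝 0) := by
  have t := ENNReal.Tendsto.const_mul (a := ‖c‖ₑ) tf (Or.inr (by simp))
  rw [mul_zero] at t
  refine t.congr fun k => ?_
  rw [eLpNorm_congr_ae (hh k), eLpNorm_const_smul]

theorem gradient_add_of_contDiff {w v : Space n → ℝ} (hw : ContDiff ℝ ∞ w) (hv : ContDiff ℝ ∞ v)
    (x : Space n) : gradient (w + v) x = gradient w x + gradient v x := by
  unfold gradient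
  rw [fderiv_add (hw.differentiable (by simp)).differentiableAt
    (hv.differentiable (by simp)).differentiableAt, map_add]

theorem gradient_smul_of_contDiff (c : ℝ) {w : Space n → ℝ} (hw : ContDiff ℝ ∞ w)
    (x : Space n) : gradient (c • w) x = c • gradient w x := by
  unfold gradient
  rw [fderiv_const_smul (hw.differentiable (by simp)).differentiableAt, map_smul]

theorem hasTraceOn_add {S : Set (Space n)} {u v : H1 Ω} (hu : HasTraceOn S u 0)
    (hv : HasTraceOn S v 0) : HasTraceOn S (u + v) 0 := by
  obtain ⟨w, hw, a1, a2, a3⟩ := hu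
  obtain ⟨z, hz, b1, b2, b3⟩ := hv
  refine ⟨fun k => w k + z k, fun k => (hw k).add (hz k), ?_, ?_, ?_⟩
  · refine tendsto_eLpNorm_add_zero
      (fun k => (hw k).continuous.aestronglyMeasurable.sub (Lp.aestronglyMeasurable _))
      (fun k => (hz k).continuous.aestronglyMeasurable.sub (Lp.aestronglyMeasurable _))
      (fun k => ?_) a1 b1
    filter_upwards [Lp.coeFn_add (u : L2 Ω) (v : L2 Ω)] with x hx
    simp only [Submodule.coe_add, hx, Pi.add_apply, Pi.sub_apply]
    ring
  · refine tendsto_eLpNorm_add_zero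
      (fun k => (continuous_gradient_of_contDiff (hw k)).aestronglyMeasurable.sub
        (Lp.aestronglyMeasurable _))
      (fun k => (continuous_gradient_of_contDiff (hz k)).aestronglyMeasurable.sub
        (Lp.aestronglyMeasurable _))
      (fun k => ?_) a2 b2
    filter_upwards [Lp.coeFn_add (grad u) (grad v)] with x hx
    simp only [map_add, hx, Pi.add_apply, Pi.sub_apply, gradient_add_of_contDiff (hw k) (hz k)]
    abel
  · refine tendsto_eLpNorm_add_zero
      (fun k => (hw k).continuous.aestronglyMeasurable.sub continuous_zero.aestronglyMeasurable)
      (fun k => (hz k).continuous.aestronglyMeasurable.sub continuous_zero.aestronglyMeasurable)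
      (fun k => ae_of_all _ fun x => ?_) a3 b3
    simp only [Pi.add_apply, Pi.sub_apply, Pi.zero_apply, sub_zero]

theorem hasTraceOn_smul {S : Set (Space n)} (c : ℝ) {u : H1 Ω} (hu : HasTraceOn S u 0) :
    HasTraceOn S (c • u) 0 := by
  obtain ⟨w, hw, a1, a2, a3⟩ := hu
  refine ⟨fun k => c • w k, fun k => (hw k).const_smul c, ?_, ?_, ?_⟩
  · refine tendsto_eLpNorm_smul_zero c (fun k => ?_) a1
    filter_upwards [Lp.coeFn_smul c (u : L2 Ω)] with x hx
    simp only [Submodule.coe_smul, hx, Pi.smul_apply, smul_sub]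
  · refine tendsto_eLpNorm_smul_zero c (fun k => ?_) a2
    filter_upwards [Lp.coeFn_smul c (grad u)] with x hx
    simp only [map_smul, hx, Pi.smul_apply, gradient_smul_of_contDiff c (hw k), smul_sub]
  · refine tendsto_eLpNorm_smul_zero c (fun k => ae_of_all _ fun x => ?_) a3
    simp

theorem hasTraceOn_zero {S : Set (Space n)} : HasTraceOn S (0 : H1 Ω) 0 := by
  refine ⟨fun _ => 0, fun _ => contDiff_const, ?_, ?_, ?_⟩
  · refine tendsto_const_nhds.congr fun k => ?_
    rw [eLpNorm_congr_ae (g := 0), eLpNorm_zero]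
    filter_upwards [Lp.coeFn_zero ℝ 2 (volume.restrict (Ω : Set (Space n)))] with x hx
    simp only [Submodule.coe_zero, hx, Pi.zero_apply, sub_zero]
  · refine tendsto_const_nhds.congr fun k => ?_
    rw [eLpNorm_congr_ae (g := 0), eLpNorm_zero]
    filter_upwards [Lp.coeFn_zero (Space n) 2 (volume.restrict (Ω : Set (Space n)))] with x hx
    rw [map_zero, hx]; simp [gradient]
  · simp

end Helpers

/-- `H¹_D(Ω) = {u ∈ H¹(Ω) : u = 0 on Γ_D}`. -/
def H1D {n : ℕ} (Ω : Opens (Space n)) (ΓD : Set (Space n)) : Submodule ℝ (H1 Ω) where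
  carrier := {u | HasTraceOn ΓD u 0}
  add_mem' := hasTraceOn_add
  zero_mem' := hasTraceOn_zero
  smul_mem' := fun c _ hu => hasTraceOn_smul c hu

/-- The pairing `⟨φ ⬝ n, v⟩` on the boundary between the normal trace of `φ ∈ H(div, Ω)`, an element
of `H^{-1/2}(∂Ω)`, and the trace of `v ∈ H¹(Ω)`, an element of `H^{1/2}(∂Ω)`; by Green's formula it
is `(φ, ∇v) + (∇ ⬝ φ, v)`. -/
noncomputable def normalTracePairing {n : ℕ} {Ω : Opens (Space n)} (φ : HDiv Ω) (v : H1 Ω) : ℝ :=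
  inner ℝ (φ : L2Vec Ω) (grad v) + inner ℝ (div φ) (v : L2 Ω)

/-- `H_N(div, Ω) = {φ ∈ H(div, Ω) : φ ⬝ n = 0 on Γ_N}`. As usual, `φ ⬝ n = 0` on the part `Γ_N` of
the boundary means `⟨φ ⬝ n, v⟩ = 0` for all `v ∈ H¹(Ω)` that vanish on the rest of the boundary. -/
def HDivN {n : ℕ} (Ω : Opens (Space n)) (ΓN : Set (Space n)) : Submodule ℝ (HDiv Ω) where
  carrier := {φ | ∀ v ∈ H1D Ω (frontier (Ω : Set (Space n)) \ ΓN), normalTracePairing φ v = 0}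
  add_mem' := by
    intro φ η hφ hη v hv
    have h1 := hφ v hv
    have h2 := hη v hv
    simp only [normalTracePairing, Submodule.coe_add, map_add, inner_add_left] at h1 h2 ⊢
    linarith
  zero_mem' := by
    intro v _
    simp [normalTracePairing]
  smul_mem' := by
    intro c φ hφ v hv
    have h1 := hφ v hv
    simp only [normalTracePairing, Submodule.coe_smul, map_smul, real_inner_smul_left] at h1 ⊢
    rw [← mul_add, h1, mul_zero]

/-! ### The least-squares form -/

/-- The bilinear form
`b((φ,u),(ψ,v)) = (∇ ⬝ φ + γ u, ∇ ⬝ ψ + γ v)_Ω + (∇u + φ, ∇v + ψ)_Ω`. -/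
noncomputable def b {n : ℕ} {Ω : Opens (Space n)} (γ : ℝ) (p q : HDiv Ω × H1 Ω) : ℝ :=
  inner ℝ (div p.1 + γ • (p.2 : L2 Ω)) (div q.1 + γ • (q.2 : L2 Ω)) +
    inner ℝ (grad p.2 + (p.1 : L2Vec Ω)) (grad q.2 + (q.1 : L2Vec Ω))

/-- The linear functional `F((ψ,v)) = (f, ∇ ⬝ ψ + γ v)_Ω`. -/
noncomputable def F {n : ℕ} {Ω : Opens (Space n)} (γ : ℝ) (f : L2 Ω) (q : HDiv Ω × H1 Ω) : ℝ :=
  inner ℝ f (div q.1 + γ • (q.2 : L2 Ω))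

/-- `p` solves the least-squares problem posed on the product `V × W` of subspaces `V ⊆ H(div, Ω)`
and `W ⊆ H¹(Ω)`: `p ∈ V × W` and `b(p, q) = F(q)` for all `q ∈ V × W`. -/
def IsLeastSquaresSolution {n : ℕ} {Ω : Opens (Space n)} (γ : ℝ) (f : L2 Ω)
    (V : Submodule ℝ (HDiv Ω)) (W : Submodule ℝ (H1 Ω)) (p : HDiv Ω × H1 Ω) : Prop :=
  p ∈ V.prod W ∧ ∀ q ∈ V.prod W, b γ p q = F γ f q

end FOSLS

namespace FOSLS

variable {n : ℕ} {Ω : Opens (Space n)}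

/-! ### Closedness of the weak gradient and of the weak divergence -/

/-! With `A (φ, u) = (∇ ⬝ φ + γ u, ∇u + φ)` in the Hilbert space `L² × (L²)ⁿ`, one has `b(p, q) = (A
p, A q)` and `F(q) = ((f, 0), A q)`. The upper bound is the triangle inequality. For the lower
bound, pair `A (φ, u)` with `(u, ∇u)`: the result is `γ‖u‖² + ‖∇u‖²` plus the boundary pairing of
`φ` and `u`, which vanishes by the boundary conditions. Cauchy–Schwarz then controls `u` in `H¹`,
and `φ` and `∇ ⬝ φ` follow by subtraction (`h1NormSq_le_b_self`, `le_mul_b_self`). Since `γ > 0`, no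
Poincaré inequality is needed, and the constants depend on `γ` alone.

The variational equation on `V × W` says that `A p` is the orthogonal projection of `(f, 0)` onto
`A(V × W)`. Coercivity gives uniqueness, and existence needs this image to be complete
(`IsCoerciveOn.existsUnique`). In the discrete case it is finite-dimensional. In the continuous case
it is closed (`isClosed_map_residual`): convergent residuals force `u`, `∇u`, `φ` and `∇ ⬝ φ` to
converge, and weak derivatives and boundary conditions survive such limits. -/

/-- For a fixed test function `ψ`, both sides of the defining identity are bounded linear maps of
`u` and `g`, namely the `L²` pairings `L` with `∇ψ` and `R` with `ψ`. -/
theorem HasWeakGrad.of_tendsto {u : ℕ → L2 Ω} {g : ℕ → L2Vec Ω} {u' : L2 Ω} {g' : L2Vec Ω}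
    (h : ∀ k, HasWeakGrad Ω (u k) (g k)) (hu : Tendsto u atTop (𝓝 u'))
    (hg : Tendsto g atTop (𝓝 g')) : HasWeakGrad Ω u' g' := by
  intro ψ hψ
  let μ : Measure (Space n) := volume.restrict (Ω : Set (Space n))
  let B := ContinuousLinearMap.lsmul ℝ ℝ (E := Space n)
  let L : L2 Ω →L[ℝ] Space n := (B.lpPairing μ 2 2).flip (hψ.memLp_gradient.toLp _)
  let R : L2Vec Ω →L[ℝ] Space n := B.lpPairing μ 2 2 (hψ.memLp.toLp _)
  have hL (v : L2 Ω) : L v = ∫ x in (Ω : Set (Space n)), v x • gradient ψ x := by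
    simp only [L, ContinuousLinearMap.flip_apply, ContinuousLinearMap.lpPairing_eq_integral]
    refine integral_congr_ae ?_
    filter_upwards [hψ.memLp_gradient.coeFn_toLp] with x hx
    rw [hx]; rfl
  have hR (k : L2Vec Ω) : R k = ∫ x in (Ω : Set (Space n)), ψ x • k x := by
    simp only [R, ContinuousLinearMap.lpPairing_eq_integral]
    refine integral_congr_ae ?_
    filter_upwards [hψ.memLp.coeFn_toLp] with x hx
    rw [hx]; rfl
  rw [← hL, ← hR]
  refine tendsto_nhds_unique ((L.continuous.tendsto u').comp hu) ?_
  refine (((R.continuous.tendsto g').comp hg).neg).congr fun k => ?_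
  simpa [hL, hR] using (h k ψ hψ).symm

theorem HasWeakDiv.of_tendsto {φ : ℕ → L2Vec Ω} {d : ℕ → L2 Ω} {φ' : L2Vec Ω} {d' : L2 Ω}
    (h : ∀ k, HasWeakDiv Ω (φ k) (d k)) (hφ : Tendsto φ atTop (𝓝 φ'))
    (hd : Tendsto d atTop (𝓝 d')) : HasWeakDiv Ω φ' d' := by
  intro ψ hψ
  let μ : Measure (Space n) := volume.restrict (Ω : Set (Space n))
  let L : L2Vec Ω →L[ℝ] ℝ :=
    ((innerSL ℝ (E := Space n)).lpPairing μ 2 2).flip (hψ.memLp_gradient.toLp _)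
  let R : L2 Ω →L[ℝ] ℝ :=
    (ContinuousLinearMap.lsmul ℝ ℝ (E := ℝ)).lpPairing μ 2 2 (hψ.memLp.toLp _)
  have hL (v : L2Vec Ω) : L v = ∫ x in (Ω : Set (Space n)), inner ℝ (v x) (gradient ψ x) := by
    simp only [L, ContinuousLinearMap.flip_apply, ContinuousLinearMap.lpPairing_eq_integral]
    refine integral_congr_ae ?_
    filter_upwards [hψ.memLp_gradient.coeFn_toLp] with x hx
    rw [hx]; rfl
  have hR (k : L2 Ω) : R k = ∫ x in (Ω : Set (Space n)), ψ x • k x := by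
    simp only [R, ContinuousLinearMap.lpPairing_eq_integral]
    refine integral_congr_ae ?_
    filter_upwards [hψ.memLp.coeFn_toLp] with x hx
    rw [hx]; rfl
  rw [← hL, ← hR]
  refine tendsto_nhds_unique ((L.continuous.tendsto φ').comp hφ) ?_
  refine (((R.continuous.tendsto d').comp hd).neg).congr fun k => ?_
  simpa [hL, hR] using (h k ψ hψ).symm

/-! ### Closedness of the spaces with boundary conditions -/

/-- A diagonal argument: from the sequence approximating `u k`, pick one smooth function within
`1/(k+1)` in all three norms. The boundary values stay compared with `0`, so no trace inequality is
required. -/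
theorem HasTraceOn.of_tendsto {S : Set (Space n)} {u : ℕ → H1 Ω} {v : H1 Ω}
    (h : ∀ k, HasTraceOn S (u k) 0)
    (hu : Tendsto (fun k => (u k : L2 Ω)) atTop (𝓝 (v : L2 Ω)))
    (hg : Tendsto (fun k => grad (u k)) atTop (𝓝 (grad v))) : HasTraceOn S v 0 := by
  have hpos (k : ℕ) : (0 : ℝ≥0∞) < ((k : ℝ≥0∞) + 1)⁻¹ :=
    ENNReal.inv_pos.2 (by finiteness)
  have hlim : Tendsto (fun k : ℕ => ((k : ℝ≥0∞) + 1)⁻¹) atTop (𝓝 0) := by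
    simpa using (tendsto_add_atTop_iff_nat 1).2 ENNReal.tendsto_inv_nat_nhds_zero
  have approx (k : ℕ) : ∃ w : Space n → ℝ, ContDiff ℝ ∞ w ∧
      eLpNorm (fun x => w x - (u k : L2 Ω) x) 2 (volume.restrict (Ω : Set (Space n)))
        ≤ ((k : ℝ≥0∞) + 1)⁻¹ ∧
      eLpNorm (fun x => gradient w x - grad (u k) x) 2 (volume.restrict (Ω : Set (Space n)))
        ≤ ((k : ℝ≥0∞) + 1)⁻¹ ∧
      eLpNorm (fun x => w x - (0 : Space n → ℝ) x) 2 ((surfaceMeasure n).restrict S)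
        ≤ ((k : ℝ≥0∞) + 1)⁻¹ := by
    obtain ⟨w, hw, h1, h2, h3⟩ := h k
    obtain ⟨j, e1, e2, e3⟩ := ((h1.eventually_le_const (hpos k)).and
      ((h2.eventually_le_const (hpos k)).and (h3.eventually_le_const (hpos k)))).exists
    exact ⟨w j, hw j, e1, e2, e3⟩
  choose w hw h1 h2 h3 using approx
  have squeeze {a : ℕ → ℝ≥0∞} (ha : ∀ k, a k ≤ ((k : ℝ≥0∞) + 1)⁻¹) : Tendsto a atTop (𝓝 0) :=
    tendsto_of_tendsto_of_tendsto_of_le_of_le tendsto_const_nhds hlim (fun _ => zero_le) ha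
  refine ⟨w, hw, ?_, ?_, squeeze h3⟩
  -- Split `w k - v = (w k - u k) + (u k - v)`; the gradients below are split in the same way.
  · refine tendsto_eLpNorm_add_zero
      (fun k => (hw k).continuous.aestronglyMeasurable.sub (Lp.aestronglyMeasurable _))
      (fun k => (Lp.aestronglyMeasurable (u k : L2 Ω)).sub (Lp.aestronglyMeasurable (v : L2 Ω)))
      (fun k => ae_of_all _ fun x => ?_) (squeeze h1)
      ((Lp.tendsto_Lp_iff_tendsto_eLpNorm' _ _).1 hu)
    simp
  · refine tendsto_eLpNorm_add_zero
      (fun k => (continuous_gradient_of_contDiff (hw k)).aestronglyMeasurable.sub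
        (Lp.aestronglyMeasurable _))
      (fun k => (Lp.aestronglyMeasurable (grad (u k))).sub (Lp.aestronglyMeasurable (grad v)))
      (fun k => ae_of_all _ fun x => ?_) (squeeze h2)
      ((Lp.tendsto_Lp_iff_tendsto_eLpNorm' _ _).1 hg)
    simp

/-- Closedness of `H1D` in the graph norm, phrased with sequences because the submodule `H1 Ω`
carries only the `L²` norm. -/
theorem exists_mem_H1D_of_tendsto {S : Set (Space n)} {u : ℕ → H1 Ω} (hS : ∀ k, u k ∈ H1D Ω S)
    {u' : L2 Ω} {g' : L2Vec Ω} (hu : Tendsto (fun k => (u k : L2 Ω)) atTop (𝓝 u'))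
    (hg : Tendsto (fun k => grad (u k)) atTop (𝓝 g')) :
    ∃ v ∈ H1D Ω S, (v : L2 Ω) = u' ∧ grad v = g' := by
  have h : HasWeakGrad Ω u' g' := .of_tendsto (fun k => hasWeakGrad_grad (u k)) hu hg
  let v : H1 Ω := ⟨u', g', h⟩
  have hv : grad v = g' := (hasWeakGrad_grad v).unique h
  exact ⟨v, HasTraceOn.of_tendsto hS hu (by rwa [hv]), rfl, hv⟩

/-- The condition on the normal trace is tested against one fixed `v` at a time, and the pairing is
continuous in `φ` and `div φ`. -/
theorem exists_mem_HDivN_of_tendsto {S : Set (Space n)} {φ : ℕ → HDiv Ω}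
    (hS : ∀ k, φ k ∈ HDivN Ω S) {φ' : L2Vec Ω} {d' : L2 Ω}
    (hφ : Tendsto (fun k => (φ k : L2Vec Ω)) atTop (𝓝 φ'))
    (hd : Tendsto (fun k => div (φ k)) atTop (𝓝 d')) :
    ∃ η ∈ HDivN Ω S, (η : L2Vec Ω) = φ' ∧ div η = d' := by
  have h : HasWeakDiv Ω φ' d' := .of_tendsto (fun k => hasWeakDiv_div (φ k)) hφ hd
  let η : HDiv Ω := ⟨φ', d', h⟩
  have hη : div η = d' := (hasWeakDiv_div η).unique h
  refine ⟨η, fun v hv => ?_, rfl, hη⟩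
  have t : Tendsto (fun k => normalTracePairing (φ k) v) atTop (𝓝 (normalTracePairing η v)) := by
    simp only [normalTracePairing, hη]
    exact (hφ.inner tendsto_const_nhds).add (hd.inner tendsto_const_nhds)
  exact tendsto_nhds_unique t (tendsto_const_nhds.congr fun k => (hS k v hv).symm)

/-! ### Norm equivalence -/

/-- The first-order system operator `(φ, u) ↦ (∇ ⬝ φ + γ u, ∇u + φ)`. -/
noncomputable def residual (Ω : Opens (Space n)) (γ : ℝ) :
    HDiv Ω × H1 Ω →ₗ[ℝ] WithLp 2 (L2 Ω × L2Vec Ω) :=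
  (WithLp.linearEquiv 2 ℝ (L2 Ω × L2Vec Ω)).symm.toLinearMap ∘ₗ
    (div.coprod (γ • (H1 Ω).subtype)).prod ((HDiv Ω).subtype.coprod grad)

theorem residual_fst (γ : ℝ) (p : HDiv Ω × H1 Ω) :
    (residual Ω γ p).fst = div p.1 + γ • (p.2 : L2 Ω) := rfl

theorem residual_snd (γ : ℝ) (p : HDiv Ω × H1 Ω) :
    (residual Ω γ p).snd = grad p.2 + (p.1 : L2Vec Ω) := add_comm _ _

theorem b_eq_inner_residual (γ : ℝ) (p q : HDiv Ω × H1 Ω) :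
    b γ p q = inner ℝ (residual Ω γ p) (residual Ω γ q) := by
  rw [WithLp.prod_inner_apply, ← WithLp.fst, ← WithLp.fst, ← WithLp.snd, ← WithLp.snd,
    residual_fst, residual_fst, residual_snd, residual_snd, b]

theorem F_eq_inner_residual (γ : ℝ) (f : L2 Ω) (q : HDiv Ω × H1 Ω) :
    F γ f q = inner ℝ (WithLp.toLp 2 (f, (0 : L2Vec Ω))) (residual Ω γ q) := by
  rw [WithLp.prod_inner_apply, ← WithLp.fst, ← WithLp.fst, ← WithLp.snd, ← WithLp.snd,
    residual_fst, F]
  simp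

theorem b_self (γ : ℝ) (p : HDiv Ω × H1 Ω) :
    b γ p p = ‖div p.1 + γ • (p.2 : L2 Ω)‖ ^ 2 + ‖grad p.2 + (p.1 : L2Vec Ω)‖ ^ 2 := by
  simp only [b, real_inner_self_eq_norm_sq]

theorem norm_add_sq_le_two_mul {E : Type*} [NormedAddCommGroup E] (x y : E) :
    ‖x + y‖ ^ 2 ≤ 2 * (‖x‖ ^ 2 + ‖y‖ ^ 2) :=
  (pow_le_pow_left₀ (norm_nonneg _) (norm_add_le x y) 2).trans (add_sq_le ..)

theorem norm_sub_sq_le_two_mul {E : Type*} [NormedAddCommGroup E] (x y : E) :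
    ‖x - y‖ ^ 2 ≤ 2 * (‖x‖ ^ 2 + ‖y‖ ^ 2) := by
  simpa [sub_eq_add_neg] using norm_add_sq_le_two_mul x (-y)

theorem b_self_le (γ : ℝ) (φ : HDiv Ω) (u : H1 Ω) :
    b γ (φ, u) (φ, u) ≤ (2 + 2 * γ ^ 2) * (h1NormSq u + hdivNormSq φ) := by
  have h1 := norm_add_sq_le_two_mul (div φ) (γ • (u : L2 Ω))
  have h2 := norm_add_sq_le_two_mul (grad u) (φ : L2Vec Ω)
  rw [norm_smul, mul_pow, Real.norm_eq_abs, sq_abs] at h1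
  simp only [b_self, h1NormSq, hdivNormSq]
  -- These are the surplus terms that appear when the coefficients `2` and `2γ²` are both raised to
  -- `2 + 2γ²`.
  have e1 : 0 ≤ γ ^ 2 * ‖div φ‖ ^ 2 := by positivity
  have e2 : 0 ≤ γ ^ 2 * ‖grad u‖ ^ 2 := by positivity
  have e3 : 0 ≤ γ ^ 2 * ‖(φ : L2Vec Ω)‖ ^ 2 := by positivity
  nlinarith [sq_nonneg ‖(u : L2 Ω)‖]

/-- When the boundary pairing of `φ` and `u` vanishes, testing the residual with `(u, ∇u)` controls
the `H¹` norm of `u`. -/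
theorem h1NormSq_le_b_self {γ : ℝ} (hγ : 0 < γ) {φ : HDiv Ω} {u : H1 Ω}
    (h : normalTracePairing φ u = 0) :
    (min γ 1) ^ 2 * h1NormSq u ≤ b γ (φ, u) (φ, u) := by
  have hm : 0 < min γ 1 := lt_min hγ one_pos
  have h1 := real_inner_le_norm (div φ + γ • (u : L2 Ω)) (u : L2 Ω)
  have h2 := real_inner_le_norm (grad u + (φ : L2Vec Ω)) (grad u)
  rw [inner_add_left, real_inner_smul_left, real_inner_self_eq_norm_sq] at h1
  rw [inner_add_left, real_inner_self_eq_norm_sq] at h2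
  rw [normalTracePairing] at h
  rw [b_self, h1NormSq]
  simp only
  generalize ‖div φ + γ • (u : L2 Ω)‖ = A at *
  generalize ‖grad u + (φ : L2Vec Ω)‖ = B at *
  generalize ‖(u : L2 Ω)‖ = x at *
  generalize ‖grad u‖ = y at *
  -- Lower the coefficients `γ` and `1` to the common value `m = min γ 1`.
  have k1 : min γ 1 * x ^ 2 ≤ γ * x ^ 2 := by gcongr; exact min_le_left _ _
  have k2 : min γ 1 * y ^ 2 ≤ y ^ 2 := mul_le_of_le_one_left (sq_nonneg y) (min_le_right _ _)
  generalize min γ 1 = m at *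
  have k3 : m * (m * x ^ 2 + m * y ^ 2) ≤ m * (A * x + B * y) :=
    mul_le_mul_of_nonneg_left (by linarith) hm.le
  -- Young's inequality `2mAx ≤ A² + m²x²`, and likewise for `B`, absorbs half of the left side of
  -- `k3`.
  nlinarith [sq_nonneg (A - m * x), sq_nonneg (B - m * y)]

/-- Recover `φ = (∇u + φ) - ∇u` and `∇ ⬝ φ = (∇ ⬝ φ + γ u) - γ u`. This costs `2b + 2‖∇u‖² +
2γ²‖u‖²`; adding the `H¹` norm itself gives the factor `3 + 2γ²`. -/
theorem le_mul_b_self {γ : ℝ} (hγ : 0 < γ) {φ : HDiv Ω} {u : H1 Ω}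
    (h : normalTracePairing φ u = 0) :
    h1NormSq u + hdivNormSq φ ≤
      (2 + (3 + 2 * γ ^ 2) / (min γ 1) ^ 2) * b γ (φ, u) (φ, u) := by
  have hm : 0 < (min γ 1) ^ 2 := pow_pos (lt_min hγ one_pos) 2
  have h0 := h1NormSq_le_b_self hγ h
  have h1 := norm_sub_sq_le_two_mul (div φ + γ • (u : L2 Ω)) (γ • (u : L2 Ω))
  have h2 := norm_sub_sq_le_two_mul (grad u + (φ : L2Vec Ω)) (grad u)
  rw [add_sub_cancel_right, norm_smul, mul_pow, Real.norm_eq_abs, sq_abs] at h1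
  rw [add_sub_cancel_left] at h2
  have h3 : h1NormSq u + hdivNormSq φ ≤
      2 * b γ (φ, u) (φ, u) + (3 + 2 * γ ^ 2) * h1NormSq u := by
    simp only [b_self, h1NormSq, hdivNormSq]
    have e : 0 ≤ γ ^ 2 * ‖grad u‖ ^ 2 := by positivity
    nlinarith [sq_nonneg ‖(u : L2 Ω)‖]
  have h4 : h1NormSq u ≤ b γ (φ, u) (φ, u) / (min γ 1) ^ 2 := by
    rwa [le_div_iff₀' hm]
  calc h1NormSq u + hdivNormSq φ
      ≤ 2 * b γ (φ, u) (φ, u) + (3 + 2 * γ ^ 2) * (b γ (φ, u) (φ, u) / (min γ 1) ^ 2) :=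
        h3.trans (by gcongr)
    _ = _ := by ring

/-! ### Solvability of the least-squares problem -/

theorem h1NormSq_nonneg (u : H1 Ω) : 0 ≤ h1NormSq u := by unfold h1NormSq; positivity

theorem hdivNormSq_nonneg (φ : HDiv Ω) : 0 ≤ hdivNormSq φ := by unfold hdivNormSq; positivity

/-- Coercivity of `b` on `V × W`. -/
def IsCoerciveOn (γ c : ℝ) (V : Submodule ℝ (HDiv Ω)) (W : Submodule ℝ (H1 Ω)) : Prop :=
  ∀ φ ∈ V, ∀ u ∈ W, c * (h1NormSq u + hdivNormSq φ) ≤ b γ (φ, u) (φ, u)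

theorem IsCoerciveOn.mono {γ c : ℝ} {V V' : Submodule ℝ (HDiv Ω)} {W W' : Submodule ℝ (H1 Ω)}
    (h : IsCoerciveOn γ c V W) (hV : V' ≤ V) (hW : W' ≤ W) : IsCoerciveOn γ c V' W' :=
  fun φ hφ u hu => h φ (hV hφ) u (hW hu)

theorem IsCoerciveOn.eq_zero {γ c : ℝ} (hc : 0 < c) {V : Submodule ℝ (HDiv Ω)}
    {W : Submodule ℝ (H1 Ω)} (h : IsCoerciveOn γ c V W) {p : HDiv Ω × H1 Ω} (hp : p ∈ V.prod W)
    (h0 : b γ p p = 0) : p = 0 := by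
  have h1 := h p.1 hp.1 p.2 hp.2
  rw [Prod.mk.eta, h0] at h1
  have h2 : h1NormSq p.2 + hdivNormSq p.1 ≤ 0 := nonpos_of_mul_nonpos_right h1 hc
  simp only [h1NormSq, hdivNormSq] at h2
  have hu : ‖(p.2 : L2 Ω)‖ ^ 2 = 0 := le_antisymm
    (by nlinarith [sq_nonneg ‖grad p.2‖, sq_nonneg ‖(p.1 : L2Vec Ω)‖, sq_nonneg ‖div p.1‖])
    (sq_nonneg _)
  have hφ : ‖(p.1 : L2Vec Ω)‖ ^ 2 = 0 := le_antisymm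
    (by nlinarith [sq_nonneg ‖grad p.2‖, sq_nonneg ‖(p.2 : L2 Ω)‖, sq_nonneg ‖div p.1‖])
    (sq_nonneg _)
  refine Prod.ext (Subtype.ext ?_) (Subtype.ext ?_)
  · simpa using hφ
  · simpa using hu

/-- The least-squares problem is uniquely solvable if `b` is coercive and the image of `V × W` under
the first-order system operator is complete. -/
theorem IsCoerciveOn.existsUnique {γ c : ℝ} (hc : 0 < c) {V : Submodule ℝ (HDiv Ω)}
    {W : Submodule ℝ (H1 Ω)} (h : IsCoerciveOn γ c V W)
    [((V.prod W).map (residual Ω γ)).HasOrthogonalProjection] (f : L2 Ω) :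
    ∃! p : HDiv Ω × H1 Ω, IsLeastSquaresSolution γ f V W p := by
  let M := (V.prod W).map (residual Ω γ)
  let y : WithLp 2 (L2 Ω × L2Vec Ω) := WithLp.toLp 2 (f, 0)
  -- The solution is a preimage of the projection of `(f, 0)`; orthogonality of the error to `M` is
  -- the variational equation.
  obtain ⟨p, hp, hpy⟩ := Submodule.mem_map.1 (M.starProjection_apply_mem y)
  refine ⟨p, ⟨hp, fun q hq => ?_⟩, fun p' hp' => ?_⟩
  · have := M.starProjection_inner_eq_zero y _ (Submodule.mem_map_of_mem hq)
    rw [inner_sub_left, sub_eq_zero] at this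
    rw [b_eq_inner_residual, F_eq_inner_residual, hpy]
    exact this.symm
  -- Test both equations with the difference `p' - p` itself: this gives `b(p' - p, p' - p) = 0`.
  · have hmem : p' - p ∈ V.prod W := sub_mem hp'.1 hp
    refine sub_eq_zero.1 (h.eq_zero hc hmem ?_)
    have h1 := M.starProjection_inner_eq_zero y _ (Submodule.mem_map_of_mem hmem)
    have h2 := hp'.2 _ hmem
    rw [b_eq_inner_residual, F_eq_inner_residual] at h2
    rw [← hpy, inner_sub_left] at h1
    rw [b_eq_inner_residual, map_sub, inner_sub_left, ← map_sub, h2]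
    exact h1

theorem cauchySeq_of_mul_norm_sub_sq_le {E G : Type*} [NormedAddCommGroup E]
    [NormedAddCommGroup G] {c : ℝ} (hc : 0 < c) {a : ℕ → E} {z : ℕ → G} (hz : CauchySeq z)
    (h : ∀ i j, c * ‖a i - a j‖ ^ 2 ≤ ‖z i - z j‖ ^ 2) : CauchySeq a := by
  have key (i j : ℕ) : √c * dist (a i) (a j) ≤ dist (z i) (z j) := by
    rw [dist_eq_norm, dist_eq_norm]
    refine le_of_sq_le_sq ?_ (norm_nonneg _)
    rw [mul_pow, Real.sq_sqrt hc.le]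
    exact h i j
  rw [Metric.cauchySeq_iff'] at hz ⊢
  intro ε hε
  obtain ⟨N, hN⟩ := hz (√c * ε) (mul_pos (Real.sqrt_pos.2 hc) hε)
  exact ⟨N, fun k hk =>
    lt_of_mul_lt_mul_left ((key k N).trans_lt (hN k hk)) (Real.sqrt_nonneg c)⟩

/-- Every quantity that is controlled by the norm of the product space converges along a sequence
with convergent residuals. -/
theorem IsCoerciveOn.exists_tendsto {γ c : ℝ} (hc : 0 < c) {V : Submodule ℝ (HDiv Ω)}
    {W : Submodule ℝ (H1 Ω)} (h : IsCoerciveOn γ c V W) {E : Type*} [NormedAddCommGroup E]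
    [NormedSpace ℝ E] [CompleteSpace E] (L : HDiv Ω × H1 Ω →ₗ[ℝ] E)
    (hL : ∀ q, ‖L q‖ ^ 2 ≤ h1NormSq q.2 + hdivNormSq q.1) {p : ℕ → HDiv Ω × H1 Ω}
    (hp : ∀ k, p k ∈ V.prod W) (hz : CauchySeq fun k => residual Ω γ (p k)) :
    ∃ a, Tendsto (fun k => L (p k)) atTop (𝓝 a) := by
  refine cauchySeq_tendsto_of_complete (cauchySeq_of_mul_norm_sub_sq_le hc hz fun i j => ?_)
  -- Coercivity at `p i - p j`, where `b` is the squared distance of the residuals.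
  have h1 := h _ (sub_mem (hp i).1 (hp j).1) _ (sub_mem (hp i).2 (hp j).2)
  rw [b_eq_inner_residual, real_inner_self_eq_norm_sq] at h1
  rw [← map_sub, ← map_sub]
  exact (mul_le_mul_of_nonneg_left (hL (p i - p j)) hc.le).trans h1

theorem isClosed_map_residual {γ c : ℝ} (hc : 0 < c) {S T : Set (Space n)}
    (h : IsCoerciveOn γ c (HDivN Ω S) (H1D Ω T)) :
    IsClosed (((HDivN Ω S).prod (H1D Ω T)).map (residual Ω γ) :
      Set (WithLp 2 (L2 Ω × L2Vec Ω))) := by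
  refine isClosed_of_closure_subset fun y hy => ?_
  obtain ⟨z, hz, hzy⟩ := mem_closure_iff_seq_limit.1 hy
  choose p hp hpz using fun k => Submodule.mem_map.1 (hz k)
  have hres : CauchySeq fun k => residual Ω γ (p k) := by simpa only [hpz] using hzy.cauchySeq
  -- The squared norms of `u`, `∇u`, `φ` and `∇ ⬝ φ` are the four summands of the squared product
  -- norm, so each of them converges.
  obtain ⟨u', hu⟩ := h.exists_tendsto hc ((H1 Ω).subtype ∘ₗ LinearMap.snd ℝ _ _)
    (fun q => (le_add_of_nonneg_right (sq_nonneg _)).trans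
      (le_add_of_nonneg_right (hdivNormSq_nonneg q.1))) hp hres
  obtain ⟨g', hg⟩ := h.exists_tendsto hc (grad ∘ₗ LinearMap.snd ℝ _ _)
    (fun q => (le_add_of_nonneg_left (sq_nonneg _)).trans
      (le_add_of_nonneg_right (hdivNormSq_nonneg q.1))) hp hres
  obtain ⟨φ', hφ⟩ := h.exists_tendsto hc ((HDiv Ω).subtype ∘ₗ LinearMap.fst ℝ _ _)
    (fun q => (le_add_of_nonneg_right (sq_nonneg _)).trans
      (le_add_of_nonneg_left (h1NormSq_nonneg q.2))) hp hres
  obtain ⟨d', hd⟩ := h.exists_tendsto hc (div ∘ₗ LinearMap.fst ℝ _ _)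
    (fun q => (le_add_of_nonneg_left (sq_nonneg _)).trans
      (le_add_of_nonneg_left (h1NormSq_nonneg q.2))) hp hres
  obtain ⟨u, huT, rfl, rfl⟩ := exists_mem_H1D_of_tendsto (fun k => (hp k).2) hu hg
  obtain ⟨φ, hφS, rfl, rfl⟩ := exists_mem_HDivN_of_tendsto (fun k => (hp k).1) hφ hd
  refine Submodule.mem_map.2 ⟨(φ, u), ⟨hφS, huT⟩, ?_⟩
  -- Each residual component is a continuous expression in the four limits, so uniqueness of limits
  -- identifies it with that of `y`.
  have t1 := ((WithLp.fstL 2 ℝ (L2 Ω) (L2Vec Ω)).continuous.tendsto y).comp hzy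
  have t2 := ((WithLp.sndL 2 ℝ (L2 Ω) (L2Vec Ω)).continuous.tendsto y).comp hzy
  have e1 : (residual Ω γ (φ, u)).fst = y.fst := by
    refine tendsto_nhds_unique (hd.add (hu.const_smul γ)) (t1.congr fun k => ?_)
    simp only [Function.comp_apply, ← hpz]
    exact residual_fst γ (p k)
  have e2 : (residual Ω γ (φ, u)).snd = y.snd := by
    rw [residual_snd]
    refine tendsto_nhds_unique (hg.add hφ) (t2.congr fun k => ?_)
    simp only [Function.comp_apply, ← hpz]
    exact residual_snd γ (p k)
  exact WithLp.ofLp_injective 2 (Prod.ext e1 e2)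

end FOSLS

/-! ### Well-posedness of the least-squares problem with mixed boundary conditions -/

theorem mainTheorem7 (n : ℕ) (hn : n = 2 ∨ n = 3)
    (Ω : TopologicalSpace.Opens (FOSLS.Space n))
    (hΩ_bounded : Bornology.IsBounded (Ω : Set (FOSLS.Space n)))
    (hΩ_sc : IsSimplyConnected (Ω : Set (FOSLS.Space n)))
    (hΩ_smooth : FOSLS.HasSmoothBoundary (Ω : Set (FOSLS.Space n)))
    (ΓD ΓN : Set (FOSLS.Space n)) (hΓD : MeasurableSet ΓD) (hΓN : MeasurableSet ΓN)
    (hΓ_disj : Disjoint ΓD ΓN) (hΓ_union : ΓD ∪ ΓN = frontier (Ω : Set (FOSLS.Space n)))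
    (γ : ℝ) (hγ : 0 < γ) :
    -- norm equivalence
    (∃ c C : ℝ, 0 < c ∧ 0 < C ∧
      ∀ φ ∈ FOSLS.HDivN Ω ΓN, ∀ u ∈ FOSLS.H1D Ω ΓD,
        c * (FOSLS.h1NormSq u + FOSLS.hdivNormSq φ) ≤ FOSLS.b γ (φ, u) (φ, u) ∧
        FOSLS.b γ (φ, u) (φ, u) ≤ C * (FOSLS.h1NormSq u + FOSLS.hdivNormSq φ)) ∧
    -- unique solvability of the continuous problem
    (∀ f : FOSLS.L2 Ω, ∃! p : FOSLS.HDiv Ω × FOSLS.H1 Ω,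
      FOSLS.IsLeastSquaresSolution γ f (FOSLS.HDivN Ω ΓN) (FOSLS.H1D Ω ΓD) p) ∧
    -- unique solvability of the discrete problems, for all conforming discrete spaces
    (∀ V : Submodule ℝ (FOSLS.HDiv Ω), V ≤ FOSLS.HDivN Ω ΓN → FiniteDimensional ℝ V →
      ∀ W : Submodule ℝ (FOSLS.H1 Ω), W ≤ FOSLS.H1D Ω ΓD → FiniteDimensional ℝ W →
        ∀ f : FOSLS.L2 Ω, ∃! p : FOSLS.HDiv Ω × FOSLS.H1 Ω,
          FOSLS.IsLeastSquaresSolution γ f V W p) := by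
  -- `HDivN` is defined by testing against functions vanishing on `∂Ω \ Γ_N`; as the two parts
  -- partition `∂Ω`, these are exactly the elements of `H1D Ω ΓD`.
  have hD : frontier (Ω : Set (FOSLS.Space n)) \ ΓN = ΓD := by
    rw [← hΓ_union, Set.union_sdiff_right, hΓ_disj.sdiff_eq_left]
  have hpair : ∀ φ ∈ FOSLS.HDivN Ω ΓN, ∀ u ∈ FOSLS.H1D Ω ΓD,
      FOSLS.normalTracePairing φ u = 0 := fun φ hφ u hu => hφ u (by rwa [hD])
  have hK : 0 < 2 + (3 + 2 * γ ^ 2) / (min γ 1) ^ 2 := by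
    have : 0 < min γ 1 := lt_min hγ one_pos
    positivity
  have hc := inv_pos.2 hK
  have hcoer : FOSLS.IsCoerciveOn γ (2 + (3 + 2 * γ ^ 2) / (min γ 1) ^ 2)⁻¹
      (FOSLS.HDivN Ω ΓN) (FOSLS.H1D Ω ΓD) := fun φ hφ u hu => by
    rw [inv_mul_le_iff₀ hK]
    exact FOSLS.le_mul_b_self hγ (hpair φ hφ u hu)
  refine ⟨⟨_, 2 + 2 * γ ^ 2, hc, by positivity, fun φ hφ u hu =>
    ⟨hcoer φ hφ u hu, FOSLS.b_self_le γ φ u⟩⟩, fun f => ?_, fun V hV hVfin W hW hWfin f => ?_⟩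
  -- A closed subspace of a Hilbert space is complete, which supplies the orthogonal projection.
  · have := (FOSLS.isClosed_map_residual hc hcoer).completeSpace_coe
    exact hcoer.existsUnique hc f
  -- The image of `V × W` is then finite-dimensional, hence complete, and coercivity is inherited by
  -- subspaces.
  · have : FiniteDimensional ℝ (V.prod W) := Module.Finite.iff_fg.2
      ((Module.Finite.iff_fg.1 hVfin).prod
        (Module.Finite.iff_fg.1 hWfin))
    exact (hcoer.mono hV hW).existsUnique hc f
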